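/- Let $p\ge 1$ and let $g\in C^2(\mathbb{R}^p)$ be $m$-strongly convex with $M$-Lipschitz gradient, $m>0$, i.e. for all $x,y\in\mathbb{R}^p$ $$g(x)-g(y)\ge\langle\nabla g(y),x-y\rangle+\tfrac m2|x-y|^2,\qquad |\nabla g(x)-\nabla g(y)|\le M|x-y|,$$ and let $x^*$ be its minimizer. Let $H\in\mathbb{R}^{p\times p}$ be a constant symmetric matrix with $m_H I\le H\le M_H I$ (Loewner order), where $0<m_H\le M_H$. For $\gamma>0$ let $P$ be the one-step Markov kernel of the preconditioned Langevin Monte Carlo chain $$x_{k+1}=x_k-\gamma H\nabla g(x_k)+\sqrt{2\gamma}\,H^{1/2}\xi_{k+1},\qquad \xi_{k+1}\sim N(0,I)\ \text{i.i.d.}$$ Put $$\tilde\lambda=1-2\gamma m\,m_H+\gamma^2M_H^2M^2,\quad b=2\gamma p,\quad \tilde b=b+1-\tilde\lambda,\quad \tilde V(x)=(x-x^*)^{\mathsf T}H^{-1}(x-x^*)+1,$$ and for $\alpha\in(\tilde\lambda,1)$ put $d=\dfrac{2\tilde b}{\alpha-\tilde\lambda}$, $C=\{x:\tilde V(x)\le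 d\}$ and $$\eta=\frac{\mathrm{Leb}(C)}{(2\pi)^{p/2}M_H^{p/2}}\ \inf_{x,y\in C}\exp\Big\{-\tfrac12\big(y-H\nabla g(x)\big)^{\mathsf T}H^{-1}\big(y-H\nabla g(x)\big)\Big\}.$$ Suppose that $0<\gamma<\dfrac{2\,m\,m_H}{M_H^2M^2}$. Then the chain has a stationary probability distribution $\pi_\gamma$ with the following property: for every $\alpha\in(\tilde\lambda,1)$ and every $r\in(0,1)$ there is a $\rho\in[0,1)$ with $$\rho\le\max\left\{(1-\eta)^r,\ \left(\frac{1+2\tilde b+\tilde\lambda+\tilde\lambda d}{1+d}\right)^{1-r}\big(1+2\tilde b+2\tilde\lambda d\big)^r\right\}$$ such that for all $x\in\mathbb{R}^p$ and all integers $k\ge0$ $$\|P^k(x,\cdot)-\pi_\gamma\|_{TV}\le\Big(2+\frac{\tilde b}{1-\tilde\lambda}+\tilde V(x)\Big)\rho^k,$$ where $\|\mu-\nu\|_{TV}=\sup_A|\mu(A)-\nu(A)|$ over Borel sets $A$. -/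

import Mathlib

open MeasureTheory ProbabilityTheory
open scoped Matrix MatrixOrder Gradient

noncomputable section

namespace PrecLMC

/-- `p`-dimensional Euclidean space. -/
abbrev Euc (p : ℕ) : Type := EuclideanSpace ℝ (Fin p)

/-- The standing assumption on the potential: `g` is `C²`, `m`-strongly convex (in its first-order
form) and has an `M`-Lipschitz gradient. -/
structure IsStronglyConvexSmooth {p : ℕ} (g : Euc p → ℝ) (m M : ℝ) : Prop where
  contDiff : ContDiff ℝ 2 g
  pos : 0 < m
  strong_convex : ∀ x y : Euc p,
    g x - g y ≥ inner ℝ (∇ g y) (x - y) + m / 2 * ‖x - y‖ ^ 2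
  lipschitz_grad : ∀ x y : Euc p, ‖∇ g x - ∇ g y‖ ≤ M * ‖x - y‖

/-- The assumption on a constant preconditioning matrix: `0 < mH ≤ MH` and `mH I ≤ H ≤ MH I` in
the Loewner order (`A ≤ B` iff `B - A` is positive semidefinite); in particular `H` is symmetric
positive definite. -/
structure IsPreconditioner {p : ℕ} (H : Matrix (Fin p) (Fin p) ℝ) (mH MH : ℝ) : Prop where
  pos : 0 < mH
  le : mH ≤ MH
  lower : (H - mH • (1 : Matrix (Fin p) (Fin p) ℝ)).PosSemidef
  upper : (MH • (1 : Matrix (Fin p) (Fin p) ℝ) - H).PosSemidef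

/-- A matrix acting on Euclidean space. -/
abbrev act {p : ℕ} (A : Matrix (Fin p) (Fin p) ℝ) (v : Euc p) : Euc p :=
  Matrix.toEuclideanCLM (𝕜 := ℝ) A v

/-- One step of the algorithm: from the state `x` with noise `ξ` the next state is
`x - γ H ∇g(x) + √(2γ) H^{1/2} ξ`. -/
def step {p : ℕ} (g : Euc p → ℝ) (H : Matrix (Fin p) (Fin p) ℝ) (γ : ℝ) (x ξ : Euc p) : Euc p :=
  x - γ • act H (∇ g x) + √(2 * γ) • act (CFC.sqrt H) ξ

theorem measurable_grad {p : ℕ} (g : Euc p → ℝ) : Measurable (fun x => ∇ g x) :=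
  (InnerProductSpace.toDual ℝ (Euc p)).symm.continuous.measurable.comp (measurable_fderiv ℝ g)

theorem measurable_step {p : ℕ} (g : Euc p → ℝ) (H : Matrix (Fin p) (Fin p) ℝ) (γ : ℝ) :
    Measurable (fun z : Euc p × Euc p => step g H γ z.1 z.2) := by
  have h1 : Measurable (fun z : Euc p × Euc p => act H (∇ g z.1)) :=
    (Matrix.toEuclideanCLM (𝕜 := ℝ) H).continuous.measurable.comp
      ((measurable_grad g).comp measurable_fst)
  have h2 : Measurable (fun z : Euc p × Euc p => act (CFC.sqrt H) z.2) :=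
    (Matrix.toEuclideanCLM (𝕜 := ℝ) (CFC.sqrt H)).continuous.measurable.comp measurable_snd
  exact (measurable_fst.sub (h1.const_smul γ)).add (h2.const_smul (√(2 * γ)))

/-- The one-step Markov kernel `P` of the algorithm: `P(x, ·)` is the law of
`x - γ H ∇g(x) + √(2γ) H^{1/2} ξ` with `ξ` a standard Gaussian vector. -/
def lmcKernel {p : ℕ} (g : Euc p → ℝ) (H : Matrix (Fin p) (Fin p) ℝ) (γ : ℝ) :
    Kernel (Euc p) (Euc p) where
  toFun x := (stdGaussian (Euc p)).map (step g H γ x)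
  measurable' := by
    refine Measure.measurable_of_measurable_coe _ fun s hs => ?_
    have key : ∀ x : Euc p, ((stdGaussian (Euc p)).map (step g H γ x)) s
        = stdGaussian (Euc p) (Prod.mk x ⁻¹' ((fun z : Euc p × Euc p => step g H γ z.1 z.2) ⁻¹' s)) :=
      fun x => Measure.map_apply ((measurable_step g H γ).comp measurable_prodMk_left) hs
    simp only [key]
    exact measurable_measure_prodMk_left (measurable_step g H γ hs)

instance {p : ℕ} (g : Euc p → ℝ) (H : Matrix (Fin p) (Fin p) ℝ) (γ : ℝ) :
    IsMarkovKernel (lmcKernel g H γ) where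
  isProbabilityMeasure _ :=
    Measure.isProbabilityMeasure_map
      ((measurable_step g H γ).comp measurable_prodMk_left).aemeasurable

/-- Total variation distance `sup_A |μ(A) - ν(A)|` over the measurable sets. -/
def tvDist {α : Type*} [MeasurableSpace α] (μ ν : Measure α) : ℝ :=
  ⨆ A : {A : Set α // MeasurableSet A}, |μ.real A.1 - ν.real A.1|

/-- The chain with kernel `P` and stationary distribution `π` is `(B, ρ)` geometrically ergodic:
`0 ≤ ρ < 1` and `‖P^k(x, ·) - π‖_TV ≤ B(x) ρ^k` for every starting point `x` and every `k`. -/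
def IsGeometricallyErgodic {α : Type*} [MeasurableSpace α] (P : Kernel α α) (π : Measure α)
    (B : α → ℝ) (ρ : ℝ) : Prop :=
  0 ≤ ρ ∧ ρ < 1 ∧ ∀ (x : α) (k : ℕ), tvDist ((P ^ k) x) π ≤ B x * ρ ^ k

/-- The quadratic form `vᵀ H⁻¹ v`. -/
def invQuad {p : ℕ} (H : Matrix (Fin p) (Fin p) ℝ) (v : Euc p) : ℝ :=
  inner ℝ v (act H⁻¹ v)

/-- `λ̃ = 1 - 2 γ m mH + γ² MH² M²`. -/
def lamT (γ m M mH MH : ℝ) : ℝ := 1 - 2 * γ * m * mH + γ ^ 2 * MH ^ 2 * M ^ 2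

/-- `b = 2 γ p`. -/
def driftB (p : ℕ) (γ : ℝ) : ℝ := 2 * γ * p

/-- `b̃ = b + 1 - λ̃`. -/
def driftBT (p : ℕ) (γ m M mH MH : ℝ) : ℝ := driftB p γ + 1 - lamT γ m M mH MH

/-- The Lyapunov function `Ṽ(x) = (x - x*)ᵀ H⁻¹ (x - x*) + 1`. -/
def lyapT {p : ℕ} (H : Matrix (Fin p) (Fin p) ℝ) (xstar x : Euc p) : ℝ :=
  invQuad H (x - xstar) + 1

/-- The level `d = 2 b̃ / (α - λ̃)` defining the small set. -/
def level (p : ℕ) (γ m M mH MH α : ℝ) : ℝ :=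
  2 * driftBT p γ m M mH MH / (α - lamT γ m M mH MH)

/-- The small set `C = {x : Ṽ(x) ≤ d}`. -/
def smallSet {p : ℕ} (H : Matrix (Fin p) (Fin p) ℝ) (xstar : Euc p) (γ m M mH MH α : ℝ) :
    Set (Euc p) :=
  {x | lyapT H xstar x ≤ level p γ m M mH MH α}

/-- `η = Leb(C) / ((2π)^{p/2} MH^{p/2}) *
inf_{x, y ∈ C} exp (-(y - H ∇g(x))ᵀ H⁻¹ (y - H ∇g(x)) / 2)`. -/
def eta {p : ℕ} (g : Euc p → ℝ) (H : Matrix (Fin p) (Fin p) ℝ) (xstar : Euc p)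
    (γ m M mH MH α : ℝ) : ℝ :=
  volume.real (smallSet H xstar γ m M mH MH α)
      / ((2 * Real.pi) ^ ((p : ℝ) / 2) * MH ^ ((p : ℝ) / 2))
    * ⨅ z : smallSet H xstar γ m M mH MH α × smallSet H xstar γ m M mH MH α,
        Real.exp (-(1 / 2) * invQuad H ((z.2 : Euc p) - act H (∇ g (z.1 : Euc p))))

/-- The bound on the rate with free parameters `r` and `α`:
`max {(1-η)^r, ((1 + 2b̃ + λ̃ + λ̃ d)/(1 + d))^{1-r} (1 + 2b̃ + 2λ̃ d)^r}`. -/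
def rateBound {p : ℕ} (g : Euc p → ℝ) (H : Matrix (Fin p) (Fin p) ℝ) (xstar : Euc p)
    (γ m M mH MH α r : ℝ) : ℝ :=
  max ((1 - eta g H xstar γ m M mH MH α) ^ r)
    (((1 + 2 * driftBT p γ m M mH MH + lamT γ m M mH MH
          + lamT γ m M mH MH * level p γ m M mH MH α)
        / (1 + level p γ m M mH MH α)) ^ (1 - r)
      * (1 + 2 * driftBT p γ m M mH MH
          + 2 * lamT γ m M mH MH * level p γ m M mH MH α) ^ r)

end PrecLMC

end

/-! The proof bypasses drift and minorization. It produces one explicit rate `λ̃ ^ κ`, with `κ = min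
γ (1/2)`, by coupling, and then checks that the stated bound is never smaller, whatever `α` and `r`
are.

Coupling. In the norm `|H^{-1/2} v|` the map `x ↦ x - γ H∇g(x)` is a `√λ̃`-contraction, so two
copies of the chain driven by the same noise approach each other geometrically
(`norm_whiten_drift_sub_sq_le`). One Gaussian step turns distance into total variation: shifting a
standard Gaussian by `h` costs at most `|h|` (`abs_stdGaussian_sub_shift_le`). Hence the laws after
`k ≥ 1` steps differ by at most `λ̃^{k/2} |H^{-1/2}(x - y)| / √(2γ)`. Since this difference is also
at most 1, the bound may be raised to the power `2κ ≤ 1`; Bernoulli's inequality and `κ ≤ γ` then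
absorb the factor `1/(2γ)` and leave the weight `1 + V(x) + V(y)`, `V = Ṽ - 1`. With `V` bounded in
mean along the orbit of `x*`, the iterates are uniformly Cauchy over measurable sets and converge to
an invariant law (`exists_invariant_of_forgetting`).

Comparison. If the fraction in the second entry of the maximum is at least 1, so is that entry.
Otherwise `(1 - λ̃)(d - 1) > 4γp + 1`, so `C` is large and the infimum in `η` is tiny: antipodal
points of `C` make the exponent far more negative than the volume of `C` can offset. This gives `η ≤
κ(1 - λ̃)` (`eta_le`, `two_rpow_mul_exp_le`), hence `λ̃^κ ≤ 1 - κ(1 - λ̃) ≤ 1 - η ≤ (1 - η)^r`. -/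

namespace PrecLMC

open Filter Topology

/-! ### Setwise limits of probability measures -/

section SetwiseLimit

variable {α : Type*} [MeasurableSpace α]

/-- A sequence of probability measures that is Cauchy uniformly over measurable sets converges
setwise to a probability measure. -/
theorem exists_setwise_limit (μ : ℕ → Measure α) [∀ n, IsProbabilityMeasure (μ n)]
    (ε : ℕ → ℝ) (hε : Tendsto ε atTop (𝓝 0))
    (hμ : ∀ A, MeasurableSet A → ∀ k n, |(μ (k + n)).real A - (μ k).real A| ≤ ε k) :
    ∃ π : Measure α, IsProbabilityMeasure π ∧
      ∀ A, MeasurableSet A → Tendsto (fun n => (μ n).real A) atTop (𝓝 (π.real A)) := by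
  -- Measurability sits inside the existential so that `choose` yields a set function defined on all
  -- sets, with junk values off the measurable ones.
  have hlim : ∀ A : Set α, ∃ l : ℝ, MeasurableSet A →
      Tendsto (fun n => (μ n).real A) atTop (𝓝 l) := by
    intro A
    by_cases hA : MeasurableSet A
    · have hc : CauchySeq (fun n => (μ n).real A) := by
        refine cauchySeq_of_le_tendsto_0' ε (fun k n hkn => ?_) hε
        obtain ⟨j, rfl⟩ := Nat.exists_eq_add_of_le hkn
        rw [dist_comm, Real.dist_eq]
        exact hμ A hA k j
      obtain ⟨l, hl⟩ := cauchySeq_tendsto_of_complete hc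
      exact ⟨l, fun _ => hl⟩
    · exact ⟨0, fun h => absurd h hA⟩
  choose m hm using hlim
  have hm0 : ∀ A, MeasurableSet A → 0 ≤ m A := fun A hA =>
    ge_of_tendsto' (hm A hA) fun n => measureReal_nonneg
  have hunif : ∀ A, MeasurableSet A → ∀ k, |m A - (μ k).real A| ≤ ε k := by
    intro A hA k
    have h1 : Tendsto (fun n => |(μ (k + n)).real A - (μ k).real A|) atTop
        (𝓝 |m A - (μ k).real A|) := by
      have := (tendsto_add_atTop_iff_nat k).2 (hm A hA)
      simp_rw [add_comm _ k] at this
      exact (this.sub_const _).abs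
    exact le_of_tendsto' h1 fun n => hμ A hA k n
  have hempty : m ∅ = 0 := by
    refine tendsto_nhds_unique (hm ∅ .empty) ?_
    simp
  have huniv : m Set.univ = 1 := by
    refine tendsto_nhds_unique (hm _ .univ) ?_
    simp
  have hsum : ∀ f : ℕ → Set α, (∀ i, MeasurableSet (f i)) → Pairwise (Function.onFun Disjoint f) →
      HasSum (fun i => m (f i)) (m (⋃ i, f i)) := by
    intro f hf hd
    have hfin : ∀ s : Finset ℕ, m (⋃ i ∈ s, f i) = ∑ i ∈ s, m (f i) := by
      intro s
      refine tendsto_nhds_unique (hm _ (s.measurableSet_biUnion fun i _ => hf i)) ?_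
      have : ∀ n, (μ n).real (⋃ i ∈ s, f i) = ∑ i ∈ s, (μ n).real (f i) := fun n =>
        measureReal_biUnion_finset (fun i _ j _ hij => hd hij) fun i _ => hf i
      simp_rw [this]
      exact tendsto_finsetSum _ fun i _ => hm _ (hf i)
    -- Countable additivity is an exchange of the limits in `n` and in the finite partial unions,
    -- legitimate because the error `ε n` does not depend on the set.
    have h1 : TendstoUniformly (fun n (s : Finset ℕ) => (μ n).real (⋃ i ∈ s, f i))
        (fun s => ∑ i ∈ s, m (f i)) atTop := by
      rw [Metric.tendstoUniformly_iff]
      intro e he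
      filter_upwards [hε.eventually (gt_mem_nhds he)] with n hn s
      rw [← hfin, Real.dist_eq]
      exact (hunif _ (s.measurableSet_biUnion fun i _ => hf i) n).trans_lt hn
    refine h1.tendsto_of_eventually_tendsto (L := fun n => (μ n).real (⋃ i, f i))
      (Eventually.of_forall fun n => ?_) (hm _ (.iUnion hf))
    have h2 : HasSum (fun i => (μ n).real (f i)) ((μ n).real (⋃ i, f i)) := by
      have h3 : (μ n) (⋃ i, f i) = ∑' i, (μ n) (f i) := measure_iUnion hd hf
      have h4 := (ENNReal.summable_toReal (f := fun i => (μ n) (f i))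
        (h3 ▸ measure_ne_top _ _)).hasSum
      rw [← ENNReal.tsum_toReal_eq fun i => measure_ne_top _ _, ← h3] at h4
      exact h4
    refine h2.congr' (Eventually.of_forall fun s => ?_)
    exact (measureReal_biUnion_finset (fun i _ j _ hij => hd hij) fun i _ => hf i).symm
  let π : Measure α := Measure.ofMeasurable (fun A _ => ENNReal.ofReal (m A)) (by simp [hempty])
    (fun f hf hd => by
      rw [← (hsum f hf hd).tsum_eq,
        ENNReal.ofReal_tsum_of_nonneg (fun i => hm0 _ (hf i)) (hsum f hf hd).summable])
  have hπ : ∀ A, MeasurableSet A → π A = ENNReal.ofReal (m A) := fun A hA =>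
    Measure.ofMeasurable_apply A hA
  refine ⟨π, ⟨by simp [hπ _ .univ, huniv]⟩, fun A hA => ?_⟩
  rw [measureReal_def, hπ A hA, ENNReal.toReal_ofReal (hm0 A hA)]
  exact hm A hA

/-- Setwise convergence implies convergence of integrals of measurable functions with values in
the unit interval. -/
theorem tendsto_integral_of_setwise (μ : ℕ → Measure α) [∀ n, IsProbabilityMeasure (μ n)]
    (π : Measure α) [IsProbabilityMeasure π]
    (h : ∀ A, MeasurableSet A → Tendsto (fun n => (μ n).real A) atTop (𝓝 (π.real A)))
    (f : α → ℝ) (hf : Measurable f) (hf0 : ∀ x, 0 ≤ f x) (hf1 : ∀ x, f x ≤ 1) :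
    Tendsto (fun n => ∫ x, f x ∂μ n) atTop (𝓝 (∫ x, f x ∂π)) := by
  -- Layer-cake formula: it reduces the claim to dominated convergence in the level `t`.
  have hint : ∀ ν : Measure α, IsProbabilityMeasure ν →
      ∫ x, f x ∂ν = ∫ t in Set.Ioc (0 : ℝ) 1, ν.real {a | t ≤ f a} := by
    intro ν _
    refine Integrable.integral_eq_integral_Ioc_meas_le (M := 1) ?_ (ae_of_all _ hf0)
      (ae_of_all _ hf1)
    refine Integrable.of_bound hf.aestronglyMeasurable 1 (ae_of_all _ fun x => ?_)
    rw [Real.norm_eq_abs, abs_of_nonneg (hf0 x)]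
    exact hf1 x
  simp_rw [fun n => hint (μ n) inferInstance, hint π inferInstance]
  refine tendsto_integral_of_dominated_convergence (fun _ => 1) (fun n => ?_) (by simp)
    (fun n => ae_of_all _ fun t => ?_) (ae_of_all _ fun t => h _ (hf measurableSet_Ici))
  · refine Measurable.aestronglyMeasurable (Antitone.measurable fun s t hst => ?_)
    exact measureReal_mono fun a (ha : t ≤ f a) => hst.trans ha
  · rw [Real.norm_eq_abs, abs_of_nonneg measureReal_nonneg]
    exact measureReal_le_one

end SetwiseLimit

/-! ### From forgetting the starting point to an invariant law -/

section Kernel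

variable {α : Type*} [MeasurableSpace α]

instance isMarkovKernel_pow (κ : Kernel α α) [IsMarkovKernel κ] (n : ℕ) :
    IsMarkovKernel (κ ^ n) := by
  induction n with
  | zero => exact inferInstanceAs (IsMarkovKernel (Kernel.id : Kernel α α))
  | succ n ih => rw [Kernel.pow_add, pow_one]; infer_instance

theorem measurable_kernel_real (κ : Kernel α α) {A : Set α} (hA : MeasurableSet A) :
    Measurable fun x => (κ x).real A :=
  (κ.measurable_coe hA).ennreal_toReal

theorem integrable_kernel_real (κ : Kernel α α) [IsMarkovKernel κ] {A : Set α}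
    (hA : MeasurableSet A) (μ : Measure α) [IsFiniteMeasure μ] :
    Integrable (fun x => (κ x).real A) μ := by
  refine Integrable.of_bound (measurable_kernel_real κ hA).aestronglyMeasurable 1
    (ae_of_all _ fun x => ?_)
  rw [Real.norm_eq_abs, abs_of_nonneg measureReal_nonneg]
  exact measureReal_le_one

theorem bind_real_eq_integral (κ : Kernel α α) [IsMarkovKernel κ] (μ : Measure α)
    {A : Set α} (hA : MeasurableSet A) :
    (μ.bind κ).real A = ∫ x, (κ x).real A ∂μ := by
  rw [measureReal_def, Measure.bind_apply hA κ.aemeasurable]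
  exact (integral_toReal (κ.measurable_coe hA).aemeasurable
    (ae_of_all _ fun x => measure_lt_top _ _)).symm

theorem pow_add_real_eq_integral (κ : Kernel α α) [IsMarkovKernel κ] (m n : ℕ) (a : α)
    {A : Set α} (hA : MeasurableSet A) :
    ((κ ^ (m + n)) a).real A = ∫ b, ((κ ^ n) b).real A ∂((κ ^ m) a) := by
  rw [← bind_real_eq_integral _ _ hA, add_comm m n, Kernel.pow_add, Kernel.comp_apply]

/-- A Markov kernel whose iterates forget their starting point at a geometric rate, uniformly over
measurable sets and up to a weight `V` with bounded moments along one orbit, converges to an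
invariant probability measure. -/
theorem exists_invariant_of_forgetting (κ : Kernel α α) [IsMarkovKernel κ] (V : α → ℝ)
    (hV : Measurable V) (hV0 : ∀ x, 0 ≤ V x) (x₀ : α) (c ρ : ℝ) (hc : 0 ≤ c) (hρ0 : 0 ≤ ρ)
    (hρ1 : ρ < 1)
    (hforget : ∀ A, MeasurableSet A → ∀ k x y,
      |((κ ^ k) x).real A - ((κ ^ k) y).real A| ≤ ρ ^ k * (1 + V x + V y))
    (hmom : ∀ n, ∫⁻ y, ENNReal.ofReal (V y) ∂((κ ^ n) x₀) ≤ ENNReal.ofReal c) :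
    ∃ π : Measure α, IsProbabilityMeasure π ∧ Kernel.Invariant κ π ∧
      ∀ A, MeasurableSet A → ∀ k x, |((κ ^ k) x).real A - π.real A| ≤ ρ ^ k * (1 + V x + c) := by
  have hVint : ∀ n, Integrable V ((κ ^ n) x₀) := fun n =>
    ⟨hV.aestronglyMeasurable, by
      rw [hasFiniteIntegral_iff_ofReal (ae_of_all _ hV0)]
      exact (hmom n).trans_lt ENNReal.ofReal_lt_top⟩
  have hVle : ∀ n, ∫ y, V y ∂((κ ^ n) x₀) ≤ c := fun n => by
    rw [integral_eq_lintegral_of_nonneg_ae (ae_of_all _ hV0) hV.aestronglyMeasurable]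
    exact ENNReal.toReal_le_of_le_ofReal hc (hmom n)
  -- By Chapman–Kolmogorov, the law at time `n + k` is a mixture of the laws `κ ^ k` started from
  -- the state at time `n`; the forgetting bound is averaged over that state.
  have key : ∀ A, MeasurableSet A → ∀ k n x,
      |((κ ^ (n + k)) x₀).real A - ((κ ^ k) x).real A| ≤ ρ ^ k * (1 + V x + c) := by
    intro A hA k n x
    have h1 : ((κ ^ (n + k)) x₀).real A - ((κ ^ k) x).real A
        = ∫ b, (((κ ^ k) b).real A - ((κ ^ k) x).real A) ∂((κ ^ n) x₀) := by
      rw [integral_sub (integrable_kernel_real _ hA _) (integrable_const _),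
        pow_add_real_eq_integral κ n k x₀ hA]
      simp
    rw [h1]
    calc |∫ b, (((κ ^ k) b).real A - ((κ ^ k) x).real A) ∂((κ ^ n) x₀)|
        ≤ ∫ b, |((κ ^ k) b).real A - ((κ ^ k) x).real A| ∂((κ ^ n) x₀) :=
          abs_integral_le_integral_abs
      _ ≤ ∫ b, ρ ^ k * (1 + V x + V b) ∂((κ ^ n) x₀) := by
          refine integral_mono
            ((integrable_kernel_real _ hA _).sub (integrable_const _)).abs
            (((integrable_const _).add (hVint n)).const_mul _) fun b => ?_
          have := hforget A hA k b x
          simp only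
          linarith
      _ = ρ ^ k * (1 + V x + ∫ b, V b ∂((κ ^ n) x₀)) := by
          rw [integral_const_mul, integral_add (integrable_const _) (hVint n)]
          simp
      _ ≤ ρ ^ k * (1 + V x + c) := by
          gcongr
          exact hVle n
  obtain ⟨π, hπ, hlim⟩ := exists_setwise_limit (fun n => (κ ^ n) x₀)
    (fun k => ρ ^ k * (1 + V x₀ + c))
    (by simpa using (tendsto_pow_atTop_nhds_zero_of_lt_one hρ0 hρ1).mul_const (1 + V x₀ + c))
    (fun A hA k n => by rw [add_comm k n]; exact key A hA k n x₀)
  refine ⟨π, hπ, ?_, fun A hA k x => ?_⟩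
  -- Invariance: both sides are limits of the law at time `n + 1`, written as one step after time
  -- `n`. Setwise convergence suffices, so no Feller property enters.
  · refine Measure.ext fun A hA => (measureReal_eq_measureReal_iff).1 ?_
    rw [bind_real_eq_integral κ π hA]
    refine tendsto_nhds_unique (tendsto_integral_of_setwise (fun n => (κ ^ n) x₀) π hlim _
      (measurable_kernel_real κ hA) (fun _ => measureReal_nonneg) fun _ => measureReal_le_one) ?_
    have h1 := (tendsto_add_atTop_iff_nat 1).2 (hlim A hA)
    refine h1.congr fun n => ?_
    rw [pow_add_real_eq_integral κ n 1 x₀ hA, pow_one]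
  · have h1 := (tendsto_add_atTop_iff_nat k).2 (hlim A hA)
    rw [abs_sub_comm]
    exact le_of_tendsto' (h1.sub_const _).abs fun n => key A hA k n x

end Kernel

/-! ### Shifts and second moments of the standard Gaussian -/

section Gaussian

variable {E : Type*} [NormedAddCommGroup E] [InnerProductSpace ℝ E]

/-- The Lebesgue density of the standard Gaussian measure. -/
noncomputable def stdGaussianDensity (x : E) : ℝ :=
  (2 * Real.pi) ^ (-(Module.finrank ℝ E : ℝ) / 2) * Real.exp (-(1 / 2) * ‖x‖ ^ 2)

theorem stdGaussianDensity_pos (x : E) : 0 < stdGaussianDensity x := by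
  unfold stdGaussianDensity; positivity

@[fun_prop]
theorem continuous_stdGaussianDensity : Continuous (stdGaussianDensity : E → ℝ) := by
  unfold stdGaussianDensity; fun_prop

/-- The likelihood ratio of the standard Gaussian measure shifted by `h`. -/
noncomputable def shiftRatio (h x : E) : ℝ := Real.exp (inner ℝ h x - ‖h‖ ^ 2 / 2)

@[fun_prop]
theorem continuous_shiftRatio (h : E) : Continuous (shiftRatio h) := by
  unfold shiftRatio; fun_prop

theorem stdGaussianDensity_sub (h x : E) :
    stdGaussianDensity (x - h) = stdGaussianDensity x * shiftRatio h x := by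
  rw [stdGaussianDensity, stdGaussianDensity, shiftRatio, mul_assoc, ← Real.exp_add,
    norm_sub_sq_real, real_inner_comm]
  ring_nf

theorem shiftRatio_sq (h x : E) :
    shiftRatio h x ^ 2 = Real.exp (inner ℝ ((2 : ℝ) • h) x) / Real.exp (‖h‖ ^ 2) := by
  rw [shiftRatio, ← Real.exp_nat_mul, ← Real.exp_sub, inner_smul_left]
  congr 1
  simp
  ring

variable [FiniteDimensional ℝ E] [MeasurableSpace E] [BorelSpace E]

theorem integral_stdGaussianDensity : ∫ x : E, stdGaussianDensity x = 1 := by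
  unfold stdGaussianDensity
  rw [integral_const_mul, GaussianFourier.integral_rexp_neg_mul_sq_norm (by norm_num),
    show Real.pi / (1 / 2) = 2 * Real.pi by ring, ← Real.rpow_add (by positivity), neg_div,
    neg_add_cancel, Real.rpow_zero]

theorem integrable_stdGaussianDensity : Integrable (stdGaussianDensity : E → ℝ) :=
  Integrable.of_integral_ne_zero (by rw [integral_stdGaussianDensity]; exact one_ne_zero)

/-- The two finite measures have the same characteristic function. -/
theorem stdGaussian_eq_withDensity :
    stdGaussian E = volume.withDensity (fun x : E => ENNReal.ofReal (stdGaussianDensity x)) := by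
  have : IsFiniteMeasure
      (volume.withDensity (fun x : E => ENNReal.ofReal (stdGaussianDensity x))) :=
    isFiniteMeasure_withDensity_ofReal integrable_stdGaussianDensity.2
  refine Measure.ext_of_charFun (funext fun t => ?_)
  rw [charFun_stdGaussian, charFun_apply, integral_withDensity_eq_integral_toReal_smul
    (by fun_prop) (ae_of_all _ fun _ => ENNReal.ofReal_lt_top)]
  have h1 : ∀ x : E, (ENNReal.ofReal (stdGaussianDensity x)).toReal •
      Complex.exp ((inner ℝ x t : ℝ) * Complex.I)
      = (((2 * Real.pi) ^ (-(Module.finrank ℝ E : ℝ) / 2) : ℝ) : ℂ) *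
        Complex.exp (-(1 / 2 : ℂ) * ‖x‖ ^ 2 + Complex.I * (inner ℝ t x : ℝ)) := by
    intro x
    rw [ENNReal.toReal_ofReal (stdGaussianDensity_pos x).le, stdGaussianDensity,
      Complex.real_smul, Complex.exp_add, real_inner_comm]
    push_cast
    ring_nf
  simp_rw [h1]
  rw [integral_const_mul, GaussianFourier.integral_cexp_neg_mul_sq_norm_add (by norm_num),
    show (Real.pi : ℂ) / (1 / 2) = ((2 * Real.pi : ℝ) : ℂ) by push_cast; ring,
    show (Module.finrank ℝ E / 2 : ℂ) = ((Module.finrank ℝ E / 2 : ℝ) : ℂ) by push_cast; ring,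
    ← Complex.ofReal_cpow (by positivity), ← mul_assoc, ← Complex.ofReal_mul,
    ← Real.rpow_add (by positivity), neg_div (2 : ℝ), neg_add_cancel, Real.rpow_zero,
    Complex.I_sq]
  push_cast
  ring_nf

theorem stdGaussian_real_preimage_add (h : E) {A : Set E} (hA : MeasurableSet A) :
    (stdGaussian E).real ((fun x => x + h) ⁻¹' A) = ∫ x in A, shiftRatio h x ∂stdGaussian E := by
  have hA' : MeasurableSet ((fun x => x + h) ⁻¹' A) := hA.preimage (by fun_prop)
  have h1 : ∀ B : Set E, MeasurableSet B → ∀ f : E → ℝ, ∫ x in B, f x ∂stdGaussian E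
      = ∫ x in B, stdGaussianDensity x * f x := by
    intro B hB f
    rw [stdGaussian_eq_withDensity, setIntegral_withDensity_eq_setIntegral_toReal_smul (by fun_prop)
      (ae_of_all _ fun _ => ENNReal.ofReal_lt_top) _ hB]
    simp_rw [ENNReal.toReal_ofReal (stdGaussianDensity_pos _).le, smul_eq_mul]
  have h2 : (stdGaussian E).real ((fun x => x + h) ⁻¹' A)
      = ∫ _ in (fun x => x + h) ⁻¹' A, (1 : ℝ) ∂stdGaussian E := by simp
  rw [h2, h1 _ hA', h1 _ hA, ← integral_indicator hA', ← integral_indicator hA,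
    ← integral_add_right_eq_self (μ := volume) (A.indicator _) h]
  refine integral_congr_ae (ae_of_all _ fun x => ?_)
  by_cases hx : x + h ∈ A
  · simp [hx, ← stdGaussianDensity_sub]
  · simp [hx]

theorem stdGaussian_map_inner (h : E) :
    (stdGaussian E).map (fun x => inner ℝ h x) = gaussianReal 0 (‖h‖ ^ 2).toNNReal := by
  have h1 := IsGaussian.map_eq_gaussianReal (μ := stdGaussian E) (innerSL ℝ h)
  rw [integral_strongDual_stdGaussian, variance_dual_stdGaussian, innerSL_apply_norm] at h1
  exact h1

theorem integrable_exp_inner (h : E) :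
    Integrable (fun x => Real.exp (inner ℝ h x)) (stdGaussian E) := by
  have h1 := integrable_exp_mul_gaussianReal (μ := 0) (v := (‖h‖ ^ 2).toNNReal) 1
  rw [← stdGaussian_map_inner, integrable_map_measure (by fun_prop) (by fun_prop)] at h1
  simpa [Function.comp_def] using h1

theorem integral_exp_inner (h : E) :
    ∫ x, Real.exp (inner ℝ h x) ∂stdGaussian E = Real.exp (‖h‖ ^ 2 / 2) := by
  have h1 := mgf_gaussianReal (stdGaussian_map_inner h) 1
  simpa [mgf] using h1

theorem integrable_shiftRatio (h : E) : Integrable (shiftRatio h) (stdGaussian E) := by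
  simp_rw [funext fun x => show shiftRatio h x = _ from Real.exp_sub _ _]
  exact (integrable_exp_inner h).div_const _

theorem integral_shiftRatio (h : E) : ∫ x, shiftRatio h x ∂stdGaussian E = 1 := by
  simp_rw [funext fun x => show shiftRatio h x = _ from Real.exp_sub _ _]
  rw [integral_div, integral_exp_inner, div_self (Real.exp_ne_zero _)]

theorem integrable_shiftRatio_sq (h : E) :
    Integrable (fun x => shiftRatio h x ^ 2) (stdGaussian E) := by
  simp_rw [shiftRatio_sq]
  exact (integrable_exp_inner _).div_const _

theorem integral_shiftRatio_sq (h : E) :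
    ∫ x, shiftRatio h x ^ 2 ∂stdGaussian E = Real.exp (‖h‖ ^ 2) := by
  simp_rw [shiftRatio_sq]
  rw [integral_div, integral_exp_inner, ← Real.exp_sub, norm_smul]
  congr 1
  simp
  ring

/-- Shifting the standard Gaussian measure by `h` changes it by at most `‖h‖` in total
variation. -/
theorem abs_stdGaussian_sub_shift_le (h : E) {A : Set E} (hA : MeasurableSet A) :
    |(stdGaussian E).real A - (stdGaussian E).real ((fun x => x + h) ⁻¹' A)| ≤ ‖h‖ := by
  rcases le_or_gt 1 ‖h‖ with h1 | h1
  · refine le_trans (abs_sub_le_iff.2 ⟨?_, ?_⟩) h1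
    all_goals
      linarith [measureReal_le_one (μ := stdGaussian E) (s := A),
        measureReal_le_one (μ := stdGaussian E) (s := (fun x => x + h) ⁻¹' A),
        measureReal_nonneg (μ := stdGaussian E) (s := A),
        measureReal_nonneg (μ := stdGaussian E) (s := (fun x => x + h) ⁻¹' A)]
  rcases eq_or_ne h 0 with rfl | h0
  · simp
  have hpos : 0 < ‖h‖ := norm_pos_iff.2 h0
  set F : E → ℝ := fun x => 1 - shiftRatio h x with hF
  have hFint : Integrable F (stdGaussian E) := (integrable_const _).sub (integrable_shiftRatio h)
  have hF2 : ∀ x, F x ^ 2 = 1 - 2 * shiftRatio h x + shiftRatio h x ^ 2 := fun x => by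
    simp only [hF]; ring
  have hF2int : Integrable (fun x => F x ^ 2) (stdGaussian E) := by
    simp_rw [hF2]
    exact ((integrable_const _).sub ((integrable_shiftRatio h).const_mul _)).add
      (integrable_shiftRatio_sq h)
  have hF0 : ∫ x, F x ∂stdGaussian E = 0 := by
    rw [integral_sub (integrable_const _) (integrable_shiftRatio h), integral_shiftRatio]
    simp
  have hF2val : ∫ x, F x ^ 2 ∂stdGaussian E = Real.exp (‖h‖ ^ 2) - 1 := by
    simp_rw [hF2]
    have hi : Integrable (fun x => 1 - 2 * shiftRatio h x) (stdGaussian E) :=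
      (integrable_const _).sub ((integrable_shiftRatio h).const_mul _)
    rw [integral_add hi (integrable_shiftRatio_sq h), integral_sub (integrable_const _)
      ((integrable_shiftRatio h).const_mul _), integral_const_mul, integral_shiftRatio,
      integral_shiftRatio_sq]
    simp
    ring
  have hdiff : (stdGaussian E).real A - (stdGaussian E).real ((fun x => x + h) ⁻¹' A)
      = ∫ x in A, F x ∂stdGaussian E := by
    rw [stdGaussian_real_preimage_add h hA, integral_sub (integrable_const _).integrableOn
      (integrable_shiftRatio h).integrableOn]
    simp
  -- The inequality `2|F| ≤ ‖h‖ + F²/‖h‖` plays the role of Cauchy–Schwarz; the weight `‖h‖` matches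
  -- the size of `F` in mean square.
  have habs : ∫ x, |F x| ∂stdGaussian E ≤ (‖h‖ + (Real.exp (‖h‖ ^ 2) - 1) / ‖h‖) / 2 := by
    calc ∫ x, |F x| ∂stdGaussian E ≤ ∫ x, (‖h‖ + F x ^ 2 / ‖h‖) / 2 ∂stdGaussian E := by
          refine integral_mono hFint.abs
            (((integrable_const _).add (hF2int.div_const _)).div_const _) fun x => ?_
          simp only
          rw [le_div_iff₀ two_pos, ← sub_nonneg]
          have : ‖h‖ + F x ^ 2 / ‖h‖ - |F x| * 2 = (‖h‖ - |F x|) ^ 2 / ‖h‖ := by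
            rw [← sq_abs (F x)]
            field_simp
            ring
          rw [this]
          positivity
      _ = _ := by
          rw [integral_div, integral_add (integrable_const _) (hF2int.div_const _), integral_div,
            hF2val]
          simp
  have hexp : Real.exp (‖h‖ ^ 2) - 1 ≤ 2 * ‖h‖ ^ 2 := by
    have h2 : ‖h‖ ^ 2 ≤ 1 := by nlinarith
    have := Real.abs_exp_sub_one_le (x := ‖h‖ ^ 2) (by rwa [abs_of_nonneg (by positivity)])
    rw [abs_of_nonneg (sq_nonneg ‖h‖)] at this
    exact (le_abs_self _).trans this
  have hexp' : (Real.exp (‖h‖ ^ 2) - 1) / ‖h‖ ≤ 2 * ‖h‖ := by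
    rw [div_le_iff₀ hpos]
    linarith [sq ‖h‖]
  -- As `F` has mean zero, its integrals over `A` and `Aᶜ` are opposite, so each is at most half of
  -- `∫ |F| ≤ 3‖h‖/2`.
  have hsplit := integral_add_compl hA hFint
  have hsplit' := integral_add_compl hA hFint.abs
  have ha : |∫ x in A, F x ∂stdGaussian E| ≤ ∫ x in A, |F x| ∂stdGaussian E :=
    abs_integral_le_integral_abs
  have hb : |∫ x in Aᶜ, F x ∂stdGaussian E| ≤ ∫ x in Aᶜ, |F x| ∂stdGaussian E :=
    abs_integral_le_integral_abs
  rw [hF0] at hsplit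
  rw [eq_neg_of_add_eq_zero_right hsplit, abs_neg] at hb
  rw [hdiff]
  linarith

theorem integral_norm_sq_stdGaussian :
    ∫ x : E, ‖x‖ ^ 2 ∂stdGaussian E = Module.finrank ℝ E := by
  have h2 : ∀ i, ∫ x : E, inner ℝ (stdOrthonormalBasis ℝ E i) x ^ 2 ∂stdGaussian E = 1 := by
    intro i
    have h1 := variance_dual_stdGaussian (innerSL ℝ (stdOrthonormalBasis ℝ E i))
    rw [variance_of_integral_eq_zero (by fun_prop) (integral_strongDual_stdGaussian _)] at h1
    simpa using h1
  have h3 : ∀ i, Integrable (fun x : E => inner ℝ (stdOrthonormalBasis ℝ E i) x ^ 2)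
      (stdGaussian E) := fun i =>
    Integrable.of_integral_ne_zero (by rw [h2]; exact one_ne_zero)
  simp_rw [← (stdOrthonormalBasis ℝ E).sum_sq_inner_right]
  rw [integral_finsetSum _ fun i _ => h3 i]
  simp [h2]

theorem integrable_norm_sq_stdGaussian :
    Integrable (fun x : E => ‖x‖ ^ 2) (stdGaussian E) :=
  (IsGaussian.memLp_two_id (μ := stdGaussian E)).integrable_norm_pow two_ne_zero

theorem integral_norm_add_smul_sq_stdGaussian (v : E) (s : ℝ) :
    Integrable (fun x : E => ‖v + s • x‖ ^ 2) (stdGaussian E) ∧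
    ∫ x : E, ‖v + s • x‖ ^ 2 ∂stdGaussian E = ‖v‖ ^ 2 + s ^ 2 * Module.finrank ℝ E := by
  have h1 : ∀ x : E, ‖v + s • x‖ ^ 2 = ‖v‖ ^ 2 + 2 * s * inner ℝ v x + s ^ 2 * ‖x‖ ^ 2 := by
    intro x
    rw [norm_add_sq_real, inner_smul_right, norm_smul, mul_pow, Real.norm_eq_abs, sq_abs]
    ring
  have hi : Integrable (fun x : E => inner ℝ v x) (stdGaussian E) :=
    (IsGaussian.integrable_id (μ := stdGaussian E)).const_inner v
  have hi0 : ∫ x : E, inner ℝ v x ∂stdGaussian E = 0 :=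
    integral_strongDual_stdGaussian (innerSL ℝ v)
  have ha : Integrable (fun x : E => ‖v‖ ^ 2 + 2 * s * inner ℝ v x) (stdGaussian E) :=
    (integrable_const _).add (hi.const_mul _)
  have hb : Integrable (fun x : E => s ^ 2 * ‖x‖ ^ 2) (stdGaussian E) :=
    integrable_norm_sq_stdGaussian.const_mul _
  simp_rw [h1]
  refine ⟨ha.add hb, ?_⟩
  rw [integral_add ha hb, integral_add (integrable_const _) (hi.const_mul _), integral_const_mul,
    integral_const_mul, hi0, integral_norm_sq_stdGaussian]
  simp

end Gaussian

/-! ### Preconditioner and whitened norm -/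

section Linear

variable {p : ℕ}

theorem act_mul (A B : Matrix (Fin p) (Fin p) ℝ) (v : Euc p) :
    act (A * B) v = act A (act B v) := by
  simp [act]

theorem act_one (v : Euc p) : act (1 : Matrix (Fin p) (Fin p) ℝ) v = v := by
  simp [act]

theorem inner_act_left {A : Matrix (Fin p) (Fin p) ℝ} (hA : IsSelfAdjoint A) (v w : Euc p) :
    inner ℝ (act A v) w = inner ℝ v (act A w) := by
  have h : IsSelfAdjoint (Matrix.toEuclideanCLM (𝕜 := ℝ) A) := hA.map _
  exact h.isSymmetric v w

theorem inner_act_nonneg {A : Matrix (Fin p) (Fin p) ℝ} (hA : A.PosSemidef) (v : Euc p) :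
    0 ≤ inner ℝ v (act A v) := by
  rw [Matrix.inner_toEuclideanCLM]
  simpa using hA.dotProduct_mulVec_nonneg v.ofLp

variable {H : Matrix (Fin p) (Fin p) ℝ} {mH MH : ℝ}

theorem IsPreconditioner.posDef (hH : IsPreconditioner H mH MH) : H.PosDef := by
  have h1 : (mH • (1 : Matrix (Fin p) (Fin p) ℝ)).PosDef := Matrix.PosDef.one.smul hH.pos
  have h2 := h1.add_posSemidef hH.lower
  rwa [add_sub_cancel] at h2

theorem IsPreconditioner.MH_pos (hH : IsPreconditioner H mH MH) : 0 < MH := hH.pos.trans_le hH.le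

theorem IsPreconditioner.le_inner_act (hH : IsPreconditioner H mH MH) (v : Euc p) :
    mH * ‖v‖ ^ 2 ≤ inner ℝ v (act H v) := by
  have h := inner_act_nonneg hH.lower v
  simp only [act, map_sub, map_smul, map_one, _root_.sub_apply,
    _root_.smul_apply, one_apply_eq_self, inner_sub_right,
    inner_smul_right, real_inner_self_eq_norm_sq] at h ⊢
  linarith

theorem IsPreconditioner.inner_act_le (hH : IsPreconditioner H mH MH) (v : Euc p) :
    inner ℝ v (act H v) ≤ MH * ‖v‖ ^ 2 := by
  have h := inner_act_nonneg hH.upper v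
  simp only [act, map_sub, map_smul, map_one, _root_.sub_apply,
    _root_.smul_apply, one_apply_eq_self, inner_sub_right,
    inner_smul_right, real_inner_self_eq_norm_sq] at h ⊢
  linarith

theorem sqrt_mul_sqrt_of_posDef (hH : H.PosDef) : CFC.sqrt H * CFC.sqrt H = H :=
  CFC.sqrt_mul_sqrt_self H hH.posSemidef.nonneg

theorem isSelfAdjoint_sqrt (H : Matrix (Fin p) (Fin p) ℝ) : IsSelfAdjoint (CFC.sqrt H) :=
  (CFC.sqrt_nonneg H).isSelfAdjoint

theorem isUnit_det_sqrt (hH : H.PosDef) : IsUnit (CFC.sqrt H).det := by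
  have h1 := hH.det_pos.ne'
  rw [← sqrt_mul_sqrt_of_posDef hH, Matrix.det_mul] at h1
  exact (left_ne_zero_of_mul h1).isUnit

/-- The whitening map `H^{-1/2}`. -/
noncomputable abbrev whiten (H : Matrix (Fin p) (Fin p) ℝ) (v : Euc p) : Euc p :=
  act (CFC.sqrt H)⁻¹ v

theorem whiten_neg (H : Matrix (Fin p) (Fin p) ℝ) (v : Euc p) : whiten H (-v) = -whiten H v :=
  map_neg _ _

theorem act_sqrt_whiten (hH : H.PosDef) (v : Euc p) : act (CFC.sqrt H) (whiten H v) = v := by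
  rw [whiten, ← act_mul, Matrix.mul_nonsing_inv _ (isUnit_det_sqrt hH), act_one]

theorem whiten_act_sqrt (hH : H.PosDef) (v : Euc p) : whiten H (act (CFC.sqrt H) v) = v := by
  rw [whiten, ← act_mul, Matrix.nonsing_inv_mul _ (isUnit_det_sqrt hH), act_one]

theorem whiten_act (hH : H.PosDef) (v : Euc p) : whiten H (act H v) = act (CFC.sqrt H) v := by
  conv_lhs => rw [← sqrt_mul_sqrt_of_posDef hH, act_mul]
  rw [sqrt_mul_sqrt_of_posDef hH, whiten_act_sqrt hH]

theorem isSelfAdjoint_sqrt_inv (H : Matrix (Fin p) (Fin p) ℝ) :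
    IsSelfAdjoint (CFC.sqrt H)⁻¹ :=
  Matrix.IsHermitian.inv (isSelfAdjoint_sqrt H)

theorem invQuad_eq_norm_sq (hH : H.PosDef) (v : Euc p) : invQuad H v = ‖whiten H v‖ ^ 2 := by
  have h1 : H⁻¹ = (CFC.sqrt H)⁻¹ * (CFC.sqrt H)⁻¹ := by
    rw [← Matrix.mul_inv_rev, sqrt_mul_sqrt_of_posDef hH]
  rw [invQuad, h1, act_mul, ← inner_act_left (isSelfAdjoint_sqrt_inv H),
    real_inner_self_eq_norm_sq]

theorem norm_sq_act_sqrt (hH : H.PosDef) (v : Euc p) :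
    ‖act (CFC.sqrt H) v‖ ^ 2 = inner ℝ v (act H v) := by
  rw [← real_inner_self_eq_norm_sq, inner_act_left (isSelfAdjoint_sqrt H), ← act_mul,
    sqrt_mul_sqrt_of_posDef hH]

theorem IsPreconditioner.norm_sq_le (hH : IsPreconditioner H mH MH) (v : Euc p) :
    ‖v‖ ^ 2 ≤ MH * ‖whiten H v‖ ^ 2 := by
  have h := hH.inner_act_le (whiten H v)
  rwa [← norm_sq_act_sqrt hH.posDef, act_sqrt_whiten hH.posDef] at h

theorem IsPreconditioner.le_norm_sq (hH : IsPreconditioner H mH MH) (v : Euc p) :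
    mH * ‖whiten H v‖ ^ 2 ≤ ‖v‖ ^ 2 := by
  have h := hH.le_inner_act (whiten H v)
  rwa [← norm_sq_act_sqrt hH.posDef, act_sqrt_whiten hH.posDef] at h

end Linear

/-! ### Contraction of the deterministic step -/

section Gradient

variable {p : ℕ} {g : Euc p → ℝ} {m M : ℝ}

theorem IsStronglyConvexSmooth.le_inner_grad_sub (hg : IsStronglyConvexSmooth g m M) (x y : Euc p) :
    m * ‖x - y‖ ^ 2 ≤ inner ℝ (x - y) (∇ g x - ∇ g y) := by
  have h1 := hg.strong_convex x y
  have h2 := hg.strong_convex y x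
  rw [← neg_sub x y, inner_neg_right, norm_neg] at h2
  rw [real_inner_comm, inner_sub_left]
  linarith

theorem gradient_eq_zero_of_isMinOn {xstar : Euc p} (hx : IsMinOn g Set.univ xstar) :
    ∇ g xstar = 0 := by
  have h1 : IsLocalMin g xstar := hx.isLocalMin Filter.univ_mem
  rw [gradient, h1.fderiv_eq_zero, map_zero]

variable {H : Matrix (Fin p) (Fin p) ℝ} {mH MH : ℝ}

/-- The deterministic part of one step: `x - γ H ∇g(x)`. -/
noncomputable def drift (g : Euc p → ℝ) (H : Matrix (Fin p) (Fin p) ℝ) (γ : ℝ) (x : Euc p) :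
    Euc p :=
  x - γ • act H (∇ g x)

theorem drift_of_isMinOn {xstar : Euc p} (hx : IsMinOn g Set.univ xstar) (γ : ℝ) :
    drift g H γ xstar = xstar := by
  simp [drift, gradient_eq_zero_of_isMinOn hx]

theorem step_eq (g : Euc p → ℝ) (H : Matrix (Fin p) (Fin p) ℝ) (γ : ℝ) (x ξ : Euc p) :
    step g H γ x ξ = drift g H γ x + √(2 * γ) • act (CFC.sqrt H) ξ := rfl

/-- The deterministic part contracts the whitened distance. -/
theorem norm_whiten_drift_sub_sq_le (hg : IsStronglyConvexSmooth g m M)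
    (hH : IsPreconditioner H mH MH) {γ : ℝ} (hγ : 0 ≤ γ) (x y : Euc p) :
    ‖whiten H (drift g H γ x - drift g H γ y)‖ ^ 2
      ≤ lamT γ m M mH MH * ‖whiten H (x - y)‖ ^ 2 := by
  have hpd := hH.posDef
  set G := ∇ g x - ∇ g y with hG
  set u := whiten H (x - y) with hu
  have h1 : whiten H (drift g H γ x - drift g H γ y) = u - γ • act (CFC.sqrt H) G := by
    rw [← whiten_act hpd, hu, hG]
    simp only [drift, whiten, act, map_sub, map_smul, smul_sub]
    abel
  -- Whitening cancels `H` in the cross term, so strong monotonicity of `∇ g` applies directly.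
  have h2 : inner ℝ u (act (CFC.sqrt H) G) = inner ℝ (x - y) G := by
    rw [← inner_act_left (isSelfAdjoint_sqrt H), hu, act_sqrt_whiten hpd]
  have h3 := hg.le_inner_grad_sub x y
  have h4 := hH.le_norm_sq (x - y)
  have h5 := hH.norm_sq_le (x - y)
  have h6 : ‖act (CFC.sqrt H) G‖ ^ 2 ≤ MH * ‖G‖ ^ 2 := by
    rw [norm_sq_act_sqrt hpd]
    exact hH.inner_act_le G
  have h7 : ‖G‖ ^ 2 ≤ M ^ 2 * ‖x - y‖ ^ 2 := by
    rw [← mul_pow]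
    exact pow_le_pow_left₀ (norm_nonneg _) (hg.lipschitz_grad x y) 2
  have h8 : m * mH * ‖u‖ ^ 2 ≤ inner ℝ (x - y) G := by
    have := mul_le_mul_of_nonneg_left h4 hg.pos.le
    linarith
  have h9 : ‖act (CFC.sqrt H) G‖ ^ 2 ≤ MH ^ 2 * M ^ 2 * ‖u‖ ^ 2 := by
    have a1 := mul_le_mul_of_nonneg_left h7 hH.MH_pos.le
    have a2 := mul_le_mul_of_nonneg_left h5 (mul_nonneg hH.MH_pos.le (sq_nonneg M))
    linarith
  rw [h1, norm_sub_sq_real, inner_smul_right, h2, norm_smul, mul_pow, Real.norm_eq_abs, sq_abs,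
    lamT]
  have a3 := mul_le_mul_of_nonneg_left h8 hγ
  have a4 := mul_le_mul_of_nonneg_left h9 (sq_nonneg γ)
  linarith

theorem exists_ne_zero_euc (hp : 1 ≤ p) : ∃ v : Euc p, v ≠ 0 := by
  have : Nonempty (Fin p) := ⟨⟨0, hp⟩⟩
  exact exists_ne 0

/-- A factor bounding a squared norm by a positive quantity cannot be negative; `p ≥ 1` supplies the
nonzero vector. -/
theorem lamT_nonneg (hp : 1 ≤ p) (hg : IsStronglyConvexSmooth g m M)
    (hH : IsPreconditioner H mH MH) {γ : ℝ} (hγ : 0 ≤ γ) : 0 ≤ lamT γ m M mH MH := by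
  obtain ⟨v, hv⟩ := exists_ne_zero_euc hp
  have h1 := norm_whiten_drift_sub_sq_le hg hH hγ v 0
  have h2 : 0 < ‖v‖ ^ 2 := by positivity
  have h3 := hH.norm_sq_le v
  rw [sub_zero] at h1
  have h4 : 0 < ‖whiten H v‖ ^ 2 := by
    by_contra! h
    have := mul_nonpos_of_nonneg_of_nonpos hH.MH_pos.le h
    linarith
  exact nonneg_of_mul_nonneg_left ((sq_nonneg _).trans h1) h4

theorem lamT_lt_one {γ : ℝ} (hγ0 : 0 < γ) (hγ1 : γ < 2 * m * mH / (MH ^ 2 * M ^ 2)) :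
    lamT γ m M mH MH < 1 := by
  have h0 : 0 < MH ^ 2 * M ^ 2 := by
    -- A vanishing denominator makes the quotient 0 by convention, contradicting `0 < γ`.
    rcases (by positivity : 0 ≤ MH ^ 2 * M ^ 2).eq_or_lt with h | h
    · rw [← h, div_zero] at hγ1
      exact absurd hγ1 hγ0.not_gt
    · exact h
  rw [lt_div_iff₀ h0] at hγ1
  have := mul_lt_mul_of_pos_left hγ1 hγ0
  rw [lamT]
  linarith

end Gradient

/-! ### Forgetting and moments for the chain -/

section Chain

variable {p : ℕ} {g : Euc p → ℝ} {m M : ℝ} {H : Matrix (Fin p) (Fin p) ℝ} {mH MH γ : ℝ}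

theorem measurable_step_right (g : Euc p → ℝ) (H : Matrix (Fin p) (Fin p) ℝ) (γ : ℝ) (x : Euc p) :
    Measurable (step g H γ x) :=
  (measurable_step g H γ).comp measurable_prodMk_left

theorem lmcKernel_apply (g : Euc p → ℝ) (H : Matrix (Fin p) (Fin p) ℝ) (γ : ℝ) (x : Euc p) :
    lmcKernel g H γ x = (stdGaussian (Euc p)).map (step g H γ x) := rfl

/-- One step of the chain smooths: the laws from two starting points are close in total
variation. -/
theorem abs_lmcKernel_sub_le (hg : IsStronglyConvexSmooth g m M)
    (hH : IsPreconditioner H mH MH) (hγ : 0 < γ) {A : Set (Euc p)} (hA : MeasurableSet A)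
    (x y : Euc p) :
    |(lmcKernel g H γ x).real A - (lmcKernel g H γ y).real A|
      ≤ √(lamT γ m M mH MH) * (‖whiten H (x - y)‖ / √(2 * γ)) := by
  have hs : 0 < √(2 * γ) := Real.sqrt_pos.2 (by positivity)
  -- Translating the noise by `w / √(2γ)` makes up for the gap between the two drift points.
  set w := whiten H (drift g H γ y - drift g H γ x) with hw
  have hshift : ∀ ξ, step g H γ y ξ = step g H γ x (ξ + (√(2 * γ))⁻¹ • w) := by
    intro ξ
    have : act (CFC.sqrt H) w = drift g H γ y - drift g H γ x := act_sqrt_whiten hH.posDef _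
    simp only [step_eq, act, map_add, map_smul, smul_add] at this ⊢
    rw [this, smul_inv_smul₀ hs.ne']
    abel
  have h1 : ∀ z, (lmcKernel g H γ z).real A = (stdGaussian (Euc p)).real (step g H γ z ⁻¹' A) :=
    fun z => map_measureReal_apply (measurable_step_right g H γ z) hA
  have h2 : step g H γ y ⁻¹' A
      = (fun ξ => ξ + (√(2 * γ))⁻¹ • w) ⁻¹' (step g H γ x ⁻¹' A) := by
    ext ξ
    simp [hshift ξ]
  rw [h1, h1, h2]
  refine (abs_stdGaussian_sub_shift_le _ (measurable_step_right g H γ x hA)).trans ?_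
  rw [norm_smul, norm_inv, Real.norm_of_nonneg hs.le, inv_mul_eq_div, ← mul_div_assoc]
  gcongr
  rw [← abs_of_nonneg (norm_nonneg w), ← Real.sqrt_sq_eq_abs,
    ← Real.sqrt_sq (norm_nonneg (whiten H (x - y))), ← Real.sqrt_mul' _ (sq_nonneg _)]
  refine Real.sqrt_le_sqrt ?_
  have h3 := norm_whiten_drift_sub_sq_le hg hH hγ.le y x
  rwa [← neg_sub x y, whiten_neg, norm_neg] at h3

/-- Synchronous coupling: with a common first noise, the two states differ by the drift difference
alone, contracted by `√λ̃`. The final step smooths and contracts as well, hence the exponent `k +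
1`. -/
theorem abs_lmcKernel_pow_sub_le (hg : IsStronglyConvexSmooth g m M)
    (hH : IsPreconditioner H mH MH) (hγ : 0 < γ) {A : Set (Euc p)} (hA : MeasurableSet A) (k : ℕ)
    (x y : Euc p) :
    |((lmcKernel g H γ ^ (k + 1)) x).real A - ((lmcKernel g H γ ^ (k + 1)) y).real A|
      ≤ √(lamT γ m M mH MH) ^ (k + 1) * (‖whiten H (x - y)‖ / √(2 * γ)) := by
  induction k generalizing x y with
  | zero => simpa using abs_lmcKernel_sub_le hg hH hγ hA x y
  | succ k ih =>
    set f : Euc p → ℝ := fun z => ((lmcKernel g H γ ^ (k + 1)) z).real A with hf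
    have hfm : Measurable f := measurable_kernel_real _ hA
    have hfi : ∀ z, Integrable (fun ξ => f (step g H γ z ξ)) (stdGaussian (Euc p)) := fun z => by
      have h1 := integrable_kernel_real (lmcKernel g H γ ^ (k + 1)) hA (lmcKernel g H γ z)
      rw [lmcKernel_apply] at h1
      exact h1.comp_measurable (measurable_step_right g H γ z)
    have hstep : ∀ z, ((lmcKernel g H γ ^ (k + 1 + 1)) z).real A
        = ∫ ξ, f (step g H γ z ξ) ∂stdGaussian (Euc p) := by
      intro z
      rw [add_comm (k + 1) 1, pow_add_real_eq_integral _ _ _ _ hA, pow_one, lmcKernel_apply,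
        integral_map (measurable_step_right g H γ z).aemeasurable hfm.aestronglyMeasurable]
    rw [hstep, hstep, ← integral_sub (hfi x) (hfi y)]
    have hdiff : ∀ ξ, step g H γ x ξ - step g H γ y ξ = drift g H γ x - drift g H γ y := by
      intro ξ
      rw [step_eq, step_eq]
      abel
    have hcontr : ‖whiten H (drift g H γ x - drift g H γ y)‖
        ≤ √(lamT γ m M mH MH) * ‖whiten H (x - y)‖ := by
      have h3 := Real.sqrt_le_sqrt (norm_whiten_drift_sub_sq_le hg hH hγ.le x y)
      rwa [Real.sqrt_mul' _ (sq_nonneg _), Real.sqrt_sq (norm_nonneg _),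
        Real.sqrt_sq (norm_nonneg _)] at h3
    have hbound : ∀ ξ, ‖f (step g H γ x ξ) - f (step g H γ y ξ)‖
        ≤ √(lamT γ m M mH MH) ^ (k + 1 + 1) * (‖whiten H (x - y)‖ / √(2 * γ)) := by
      intro ξ
      refine (ih (step g H γ x ξ) (step g H γ y ξ)).trans ?_
      rw [hdiff, pow_succ _ (k + 1), mul_assoc, ← mul_div_assoc (√(lamT γ m M mH MH))]
      gcongr
    have h := norm_integral_le_of_norm_le_const (μ := stdGaussian (Euc p)) (ae_of_all _ hbound)
    rwa [probReal_univ, mul_one] at h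

/-- On `[0, 1]`, lowering the exponent from 1 to `2κ` only increases `D`. -/
theorem le_rpow_of_sq_le {D a κ : ℝ} (hD0 : 0 ≤ D) (hD1 : D ≤ 1) (h : D ^ 2 ≤ a) (hκ0 : 0 < κ)
    (hκ1 : κ ≤ 1 / 2) : D ≤ a ^ κ := by
  calc D = D ^ (1 : ℝ) := (Real.rpow_one D).symm
    _ ≤ D ^ (2 * κ) := by
        rcases hD0.eq_or_lt with h0 | h0
        · rw [← h0, Real.zero_rpow one_ne_zero, Real.zero_rpow (by positivity)]
        · exact Real.rpow_le_rpow_of_exponent_ge h0 hD1 (by linarith)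
    _ = (D ^ 2) ^ κ := by
        rw [Real.rpow_mul hD0]
        norm_num
    _ ≤ a ^ κ := Real.rpow_le_rpow (sq_nonneg D) h hκ0.le

/-- The exponent in the convergence rate of the chain. -/
noncomputable def rateExponent (γ : ℝ) : ℝ := min γ (1 / 2)

theorem rateExponent_pos (hγ : 0 < γ) : 0 < rateExponent γ := lt_min hγ (by norm_num)

/-- The chain forgets its starting point at the rate `λ̃ ^ min(γ, 1/2)`. -/
theorem abs_lmcKernel_pow_sub_le_rate (hp : 1 ≤ p) (hg : IsStronglyConvexSmooth g m M)
    (hH : IsPreconditioner H mH MH) (hγ : 0 < γ) (xstar : Euc p) {A : Set (Euc p)}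
    (hA : MeasurableSet A) (k : ℕ) (x y : Euc p) :
    |((lmcKernel g H γ ^ k) x).real A - ((lmcKernel g H γ ^ k) y).real A|
      ≤ (lamT γ m M mH MH ^ rateExponent γ) ^ k
        * (1 + invQuad H (x - xstar) + invQuad H (y - xstar)) := by
  have hl0 := lamT_nonneg hp hg hH hγ.le
  have hκ := rateExponent_pos hγ
  rw [invQuad_eq_norm_sq hH.posDef, invQuad_eq_norm_sq hH.posDef]
  have hD1 : |((lmcKernel g H γ ^ k) x).real A - ((lmcKernel g H γ ^ k) y).real A| ≤ 1 := by
    refine abs_sub_le_iff.2 ⟨?_, ?_⟩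
    · linarith [measureReal_le_one (μ := (lmcKernel g H γ ^ k) x) (s := A),
        measureReal_nonneg (μ := (lmcKernel g H γ ^ k) y) (s := A)]
    · linarith [measureReal_le_one (μ := (lmcKernel g H γ ^ k) y) (s := A),
        measureReal_nonneg (μ := (lmcKernel g H γ ^ k) x) (s := A)]
  rcases k with _ | k
  · rw [pow_zero (lamT γ m M mH MH ^ rateExponent γ), one_mul]
    linarith [sq_nonneg ‖whiten H (x - xstar)‖, sq_nonneg ‖whiten H (y - xstar)‖]
  set D := |((lmcKernel g H γ ^ (k + 1)) x).real A - ((lmcKernel g H γ ^ (k + 1)) y).real A|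
  set Z := ‖whiten H (x - y)‖ ^ 2 with hZ
  have hZ0 : 0 ≤ Z := sq_nonneg _
  have hZle : Z ≤ 2 * ‖whiten H (x - xstar)‖ ^ 2 + 2 * ‖whiten H (y - xstar)‖ ^ 2 := by
    have h1 : whiten H (x - y) = whiten H (x - xstar) - whiten H (y - xstar) := by
      simp only [whiten, act, map_sub]
      abel
    rw [hZ, h1]
    have h2 := parallelogram_law_with_norm ℝ (whiten H (x - xstar)) (whiten H (y - xstar))
    nlinarith [mul_self_nonneg ‖whiten H (x - xstar) + whiten H (y - xstar)‖]
  have hsq : D ^ 2 ≤ lamT γ m M mH MH ^ (k + 1) * (Z / (2 * γ)) := by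
    have h1 := pow_le_pow_left₀ (abs_nonneg _) (abs_lmcKernel_pow_sub_le hg hH hγ hA k x y) 2
    rwa [mul_pow, ← pow_mul, mul_comm (k + 1) 2, pow_mul, Real.sq_sqrt hl0, div_pow,
      Real.sq_sqrt (by positivity)] at h1
  have h2 := le_rpow_of_sq_le (abs_nonneg _) hD1 hsq hκ (min_le_right _ _)
  rw [Real.mul_rpow (by positivity) (by positivity), ← Real.rpow_natCast, ← Real.rpow_mul hl0,
    mul_comm ((k + 1 : ℕ) : ℝ), Real.rpow_mul hl0, Real.rpow_natCast] at h2
  refine h2.trans (mul_le_mul_of_nonneg_left ?_ (by positivity))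
  -- Bernoulli linearizes `(Z / (2γ)) ^ κ`; then `κ ≤ γ` leaves at most `1 + Z / 2`, free of `γ`.
  have h3 := rpow_one_add_le_one_add_mul_self (s := Z / (2 * γ) - 1) (p := rateExponent γ)
    (by linarith [show 0 ≤ Z / (2 * γ) by positivity]) hκ.le
    ((min_le_right _ _).trans (by norm_num))
  rw [add_sub_cancel] at h3
  have h4 : rateExponent γ * (Z / (2 * γ)) ≤ Z / 2 := by
    calc rateExponent γ * (Z / (2 * γ)) ≤ γ * (Z / (2 * γ)) := by
          gcongr
          exact min_le_left _ _
      _ = Z / 2 := by field_simp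
  linarith

/-- The Lyapunov drift condition. -/
theorem lintegral_invQuad_lmcKernel_le (hg : IsStronglyConvexSmooth g m M)
    (hH : IsPreconditioner H mH MH) (hγ : 0 < γ) {xstar : Euc p}
    (hx : IsMinOn g Set.univ xstar) (x : Euc p) :
    ∫⁻ y, ENNReal.ofReal (invQuad H (y - xstar)) ∂lmcKernel g H γ x
      ≤ ENNReal.ofReal (lamT γ m M mH MH * invQuad H (x - xstar) + 2 * γ * p) := by
  have hpd := hH.posDef
  have hm : Measurable fun y : Euc p => ENNReal.ofReal (invQuad H (y - xstar)) := by
    simp_rw [invQuad_eq_norm_sq hpd]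
    unfold whiten act
    fun_prop
  rw [lmcKernel_apply, lintegral_map hm (measurable_step_right g H γ x)]
  have h1 : ∀ ξ, invQuad H (step g H γ x ξ - xstar)
      = ‖whiten H (drift g H γ x - xstar) + √(2 * γ) • ξ‖ ^ 2 := by
    intro ξ
    rw [invQuad_eq_norm_sq hpd, step_eq, add_sub_right_comm]
    congr 2
    conv_rhs => rw [← whiten_act_sqrt hpd ξ]
    simp only [whiten, act, map_add, map_smul]
  simp_rw [h1]
  obtain ⟨hi, hv⟩ := integral_norm_add_smul_sq_stdGaussian (whiten H (drift g H γ x - xstar))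
    (√(2 * γ))
  rw [← ofReal_integral_eq_lintegral_ofReal hi (ae_of_all _ fun _ => sq_nonneg _), hv,
    Real.sq_sqrt (by positivity), finrank_euclideanSpace_fin, invQuad_eq_norm_sq hpd]
  refine ENNReal.ofReal_le_ofReal ?_
  have h2 := norm_whiten_drift_sub_sq_le hg hH hγ.le x xstar
  rw [drift_of_isMinOn hx] at h2
  linarith

/-- The bound is the fixed point of `c ↦ λ̃ c + 2γp`, and the orbit starts below it because the
quadratic form vanishes at `x*`. -/
theorem lintegral_invQuad_lmcKernel_pow_le (hp : 1 ≤ p) (hg : IsStronglyConvexSmooth g m M)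
    (hH : IsPreconditioner H mH MH) (hγ : 0 < γ) {xstar : Euc p}
    (hx : IsMinOn g Set.univ xstar) (hl : lamT γ m M mH MH < 1) (n : ℕ) :
    ∫⁻ y, ENNReal.ofReal (invQuad H (y - xstar)) ∂(lmcKernel g H γ ^ n) xstar
      ≤ ENNReal.ofReal (2 * γ * p / (1 - lamT γ m M mH MH)) := by
  have hpd := hH.posDef
  have hl0 := lamT_nonneg hp hg hH hγ.le
  have hδ : 0 < 1 - lamT γ m M mH MH := by linarith
  have hm : Measurable fun y : Euc p => ENNReal.ofReal (invQuad H (y - xstar)) := by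
    simp_rw [invQuad_eq_norm_sq hpd]
    unfold whiten act
    fun_prop
  induction n with
  | zero =>
    rw [pow_zero, show (1 : Kernel (Euc p) (Euc p)) = Kernel.id from rfl, Kernel.id_apply,
      lintegral_dirac' _ hm]
    simp [invQuad]
  | succ n ih =>
    rw [add_comm, Kernel.pow_add, pow_one, Kernel.lintegral_comp _ _ _ hm]
    have hnn : ∀ y, 0 ≤ invQuad H (y - xstar) := fun y => by
      rw [invQuad_eq_norm_sq hpd]
      positivity
    calc _ ≤ ∫⁻ y, (ENNReal.ofReal (lamT γ m M mH MH) * ENNReal.ofReal (invQuad H (y - xstar))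
            + ENNReal.ofReal (2 * γ * p)) ∂(lmcKernel g H γ ^ n) xstar := by
          refine lintegral_mono fun y => ?_
          rw [← ENNReal.ofReal_mul hl0, ← ENNReal.ofReal_add (mul_nonneg hl0 (hnn y))
            (by positivity)]
          exact lintegral_invQuad_lmcKernel_le hg hH hγ hx y
      _ = ENNReal.ofReal (lamT γ m M mH MH)
            * ∫⁻ y, ENNReal.ofReal (invQuad H (y - xstar)) ∂(lmcKernel g H γ ^ n) xstar
            + ENNReal.ofReal (2 * γ * p) := by
          rw [lintegral_add_right _ measurable_const, lintegral_const_mul _ hm]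
          simp
      _ ≤ ENNReal.ofReal (lamT γ m M mH MH)
            * ENNReal.ofReal (2 * γ * p / (1 - lamT γ m M mH MH))
            + ENNReal.ofReal (2 * γ * p) := by gcongr
      _ = ENNReal.ofReal (2 * γ * p / (1 - lamT γ m M mH MH)) := by
          rw [← ENNReal.ofReal_mul hl0, ← ENNReal.ofReal_add (by positivity) (by positivity)]
          congr 1
          field_simp
          ring

end Chain

/-! ### Comparison with the stated rate -/

section SmallSet

variable {p : ℕ} {g : Euc p → ℝ} {m M : ℝ} {H : Matrix (Fin p) (Fin p) ℝ} {mH MH γ α : ℝ}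
  {xstar : Euc p}

/-- A Chernoff bound for the Lebesgue measure of the small set. -/
theorem volume_real_smallSet_le (hH : IsPreconditioner H mH MH) :
    volume.real (smallSet H xstar γ m M mH MH α)
      ≤ (4 * Real.pi * MH) ^ ((p : ℝ) / 2) * Real.exp ((level p γ m M mH MH α - 1) / 4) := by
  have hM := hH.MH_pos
  set u := level p γ m M mH MH α - 1 with hu
  -- The coefficient `1 / (4 MH)` makes the volume grow only like `exp (u / 4)`, which the decay of
  -- the infimum in `eta`, at least `exp (-u / 2)`, overcomes.
  set f : Euc p → ℝ := fun x => Real.exp (-(1 / (4 * MH)) * ‖x - xstar‖ ^ 2) with hf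
  have hint : ∫ x, f x = (4 * Real.pi * MH) ^ ((p : ℝ) / 2) := by
    rw [integral_sub_right_eq_self (fun x : Euc p => Real.exp (-(1 / (4 * MH)) * ‖x‖ ^ 2)),
      GaussianFourier.integral_rexp_neg_mul_sq_norm (by positivity), finrank_euclideanSpace_fin]
    congr 1
    field_simp
  have hfi : Integrable f :=
    Integrable.of_integral_ne_zero (by rw [hint]; positivity)
  have hsub : smallSet H xstar γ m M mH MH α ⊆ {x | Real.exp (-(u / 4)) ≤ f x} := by
    intro x hx
    have h1 : ‖whiten H (x - xstar)‖ ^ 2 ≤ u := by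
      rw [← invQuad_eq_norm_sq hH.posDef, hu]
      have : lyapT H xstar x ≤ level p γ m M mH MH α := hx
      rw [lyapT] at this
      linarith
    have h2 := hH.norm_sq_le (x - xstar)
    have h3 : ‖x - xstar‖ ^ 2 ≤ MH * u := h2.trans (by gcongr)
    refine Real.exp_le_exp.2 ?_
    rw [neg_mul, neg_le_neg_iff, one_div_mul_eq_div, div_le_div_iff₀ (by positivity) (by norm_num)]
    linarith
  have hfin : volume {x | Real.exp (-(u / 4)) ≤ f x} ≠ ⊤ :=
    (hfi.measure_ge_lt_top (Real.exp_pos _)).ne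
  have h4 := mul_meas_ge_le_integral_of_nonneg
    (ae_of_all _ fun x => (Real.exp_pos (-(1 / (4 * MH)) * ‖x - xstar‖ ^ 2)).le) hfi
    (Real.exp (-(u / 4)))
  have h5 := measureReal_mono hsub hfin
  have h6 : Real.exp (-(u / 4)) * volume.real (smallSet H xstar γ m M mH MH α)
      ≤ (4 * Real.pi * MH) ^ ((p : ℝ) / 2) := by
    rw [← hint]
    exact (mul_le_mul_of_nonneg_left h5 (Real.exp_pos _).le).trans h4
  rw [Real.exp_neg, inv_mul_le_iff₀ (Real.exp_pos _)] at h6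
  linarith

/-- Two antipodal points of the small set make the exponent in `eta` large. -/
theorem exists_smallSet_pair (hp : 1 ≤ p) (hg : IsStronglyConvexSmooth g m M)
    (hH : IsPreconditioner H mH MH) (hx : IsMinOn g Set.univ xstar)
    (hu : 0 < level p γ m M mH MH α - 1) :
    ∃ x ∈ smallSet H xstar γ m M mH MH α, ∃ y ∈ smallSet H xstar γ m M mH MH α,
      (level p γ m M mH MH α - 1) * (1 + m * mH) ^ 2 ≤ invQuad H (y - act H (∇ g x)) := by
  have hpd := hH.posDef
  set u := level p γ m M mH MH α - 1 with hudef
  obtain ⟨w, hw, hws⟩ : ∃ w : Euc p, ‖whiten H w‖ ^ 2 = u ∧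
      inner ℝ (whiten H w) (whiten H xstar) ≤ 0 := by
    obtain ⟨v, hv⟩ := exists_ne_zero_euc hp
    have h1 : whiten H (act (CFC.sqrt H) ((√u / ‖v‖) • v)) = (√u / ‖v‖) • v := whiten_act_sqrt hpd _
    have h2 : ‖(√u / ‖v‖) • v‖ ^ 2 = u := by
      rw [norm_smul, Real.norm_of_nonneg (by positivity), div_mul_cancel₀ _ (norm_ne_zero_iff.2 hv),
        Real.sq_sqrt hu.le]
    -- The sign of `w` is chosen so that the uncentred `x*` in `y - H∇g(x)` can only lengthen the
    -- component along `-w`.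
    rcases le_total (inner ℝ ((√u / ‖v‖) • v) (whiten H xstar)) 0 with h3 | h3
    · exact ⟨_, by rw [h1, h2], by rw [h1]; exact h3⟩
    · refine ⟨-act (CFC.sqrt H) ((√u / ‖v‖) • v), ?_, ?_⟩
      · rw [whiten_neg, norm_neg, h1, h2]
      · rw [whiten_neg, h1,
          inner_neg_left]
        linarith
  have hmem : ∀ z, ‖whiten H (z - xstar)‖ ^ 2 = u → z ∈ smallSet H xstar γ m M mH MH α := by
    intro z hz
    change lyapT H xstar z ≤ level p γ m M mH MH α
    rw [lyapT, invQuad_eq_norm_sq hpd, hz, hudef]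
    linarith
  refine ⟨xstar + w, hmem _ (by rwa [add_sub_cancel_left]), xstar - w, hmem _ ?_, ?_⟩
  · rw [sub_sub_cancel_left, whiten_neg, norm_neg, hw]
  rw [invQuad_eq_norm_sq hpd]
  set G := ∇ g (xstar + w) with hG
  have h1 : whiten H (xstar - w - act H G)
      = whiten H xstar - whiten H w - act (CFC.sqrt H) G := by
    rw [← whiten_act hpd]
    simp only [whiten, act, map_sub]
  have h2 : m * mH * u ≤ inner ℝ (whiten H w) (act (CFC.sqrt H) G) := by
    rw [← inner_act_left (isSelfAdjoint_sqrt H), act_sqrt_whiten hpd]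
    have h3 := hg.le_inner_grad_sub (xstar + w) xstar
    rw [add_sub_cancel_left, gradient_eq_zero_of_isMinOn hx, sub_zero] at h3
    have h4 := mul_le_mul_of_nonneg_left (hH.le_norm_sq w) hg.pos.le
    rw [hw] at h4
    linarith
  have h5 : u * (1 + m * mH) ≤ ‖whiten H w‖ * ‖whiten H (xstar - w - act H G)‖ := by
    refine le_trans ?_ (neg_le_of_abs_le (abs_real_inner_le_norm (whiten H w) _) |> neg_le.1)
    rw [h1, inner_sub_right, inner_sub_right, real_inner_self_eq_norm_sq, hw]
    linarith
  have h6 := pow_le_pow_left₀ (mul_nonneg hu.le (by have := hg.pos; have := hH.pos; positivity)) h5 2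
  rw [mul_pow, mul_pow, hw] at h6
  exact le_of_mul_le_mul_left (by linarith) hu

theorem eta_nonneg (hH : IsPreconditioner H mH MH) : 0 ≤ eta g H xstar γ m M mH MH α := by
  have := hH.MH_pos
  unfold eta
  exact mul_nonneg (by positivity) (Real.iInf_nonneg fun _ => (Real.exp_pos _).le)

theorem eta_le (hp : 1 ≤ p) (hg : IsStronglyConvexSmooth g m M)
    (hH : IsPreconditioner H mH MH) (hx : IsMinOn g Set.univ xstar)
    (hu : 0 < level p γ m M mH MH α - 1) :
    eta g H xstar γ m M mH MH α
      ≤ 2 ^ ((p : ℝ) / 2) * Real.exp ((level p γ m M mH MH α - 1) / 4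
        - (level p γ m M mH MH α - 1) * (1 + m * mH) ^ 2 / 2) := by
  have hM := hH.MH_pos
  obtain ⟨x, hxC, y, hyC, hxy⟩ := exists_smallSet_pair hp hg hH hx hu
  have h1 : ⨅ z : smallSet H xstar γ m M mH MH α × smallSet H xstar γ m M mH MH α,
      Real.exp (-(1 / 2) * invQuad H ((z.2 : Euc p) - act H (∇ g (z.1 : Euc p))))
      ≤ Real.exp (-((level p γ m M mH MH α - 1) * (1 + m * mH) ^ 2 / 2)) := by
    refine (ciInf_le ⟨0, ?_⟩ (⟨⟨x, hxC⟩, ⟨y, hyC⟩⟩ :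
      smallSet H xstar γ m M mH MH α × smallSet H xstar γ m M mH MH α)).trans ?_
    · rintro _ ⟨z, rfl⟩
      exact (Real.exp_pos _).le
    · refine Real.exp_le_exp.2 ?_
      simp only
      linarith
  have h2 : volume.real (smallSet H xstar γ m M mH MH α)
      / ((2 * Real.pi) ^ ((p : ℝ) / 2) * MH ^ ((p : ℝ) / 2))
      ≤ 2 ^ ((p : ℝ) / 2) * Real.exp ((level p γ m M mH MH α - 1) / 4) := by
    rw [div_le_iff₀ (by positivity)]
    refine (volume_real_smallSet_le hH).trans_eq ?_
    rw [show 4 * Real.pi * MH = 2 * ((2 * Real.pi) * MH) by ring,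
      Real.mul_rpow (by positivity) (by positivity),
      Real.mul_rpow (x := 2 * Real.pi) (by positivity) hM.le]
    ring
  rw [eta, sub_eq_add_neg _ ((level p γ m M mH MH α - 1) * (1 + m * mH) ^ 2 / 2), Real.exp_add,
    ← mul_assoc]
  exact mul_le_mul h2 h1 (Real.iInf_nonneg fun _ => (Real.exp_pos _).le) (by positivity)

/-- The exponent is at most `-X - 2q - Y`, with `X = 1/(4δ)` and `Y = 1/(2γ)`. Since `exp (1 - X) ≤
4δ` and `exp (-Y) ≤ 2κ`, these terms pay for `δ` and for `κ`, while `q ≥ 1` leaves `exp (-5/2) ≤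
1/8` to cancel the factor 8. -/
theorem two_rpow_mul_exp_le {q u δ n : ℝ} (hq : 1 ≤ q) (hγ : 0 < γ) (hδ : 0 < δ) (hu : 0 < u)
    (hδn : δ ≤ 2 * γ * n) (hδu : 4 * γ * q + 1 < δ * u) :
    (2 : ℝ) ^ (q / 2) * Real.exp (u / 4 - u * (1 + n) ^ 2 / 2) ≤ rateExponent γ * δ := by
  set X := 1 / (4 * δ) with hX
  set Y := 1 / (2 * γ) with hY
  have hX0 : 0 < X := by positivity
  have hY0 : 0 < Y := by positivity
  have h1 : X ≤ u / 4 := by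
    rw [hX, div_le_div_iff₀ (by positivity) (by norm_num)]
    nlinarith [mul_pos hγ (zero_lt_one.trans_le hq)]
  have h2 : 2 * q + Y ≤ u * n := by
    have h3 : 4 * γ * q + 1 ≤ 2 * γ * n * u := hδu.le.trans (by gcongr)
    have h4 : 2 * γ * Y = 1 := by rw [hY]; field_simp
    have h5 : 2 * γ * (2 * q + Y) ≤ 2 * γ * (u * n) := by linarith
    exact le_of_mul_le_mul_left h5 (by positivity)
  have h3 : u / 4 - u * (1 + n) ^ 2 / 2 ≤ -X - 2 * q - Y := by
    nlinarith [mul_nonneg hu.le (sq_nonneg n)]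
  have h4 : (2 : ℝ) ^ (q / 2) ≤ Real.exp (q / 2) := by
    rw [← Real.exp_one_rpow]
    refine Real.rpow_le_rpow zero_le_two ?_ (by linarith)
    linarith [Real.add_one_le_exp (1 : ℝ)]
  have h5 : Real.exp (1 - X) ≤ 4 * δ := by
    have h6 : X ≤ Real.exp (X - 1) := by linarith [Real.add_one_le_exp (X - 1)]
    rw [← neg_sub, Real.exp_neg, show 4 * δ = X⁻¹ by rw [hX]; simp]
    exact inv_anti₀ hX0 h6
  have h6 : Real.exp (-Y) ≤ 2 * rateExponent γ := by
    rw [rateExponent, mul_min_of_nonneg _ _ zero_le_two]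
    refine le_min ?_ ?_
    · rw [Real.exp_neg, show 2 * γ = Y⁻¹ by rw [hY]; simp]
      exact inv_anti₀ hY0 (by linarith [Real.add_one_le_exp Y])
    · norm_num
      exact hY0.le
  have h7 : Real.exp (-(5 / 2)) ≤ 1 / 8 := by
    have h8 : (8 : ℝ) ≤ Real.exp (5 / 2) := by
      rw [show (5 / 2 : ℝ) = 1 + 1 + 1 / 2 by norm_num, Real.exp_add, Real.exp_add]
      have h9 := Real.exp_one_gt_d9
      have h10 := Real.add_one_le_exp (1 / 2 : ℝ)
      nlinarith [mul_self_le_mul_self (by norm_num : (0 : ℝ) ≤ 2.7) (by linarith : 2.7 ≤ Real.exp 1)]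
    rw [Real.exp_neg, one_div]
    exact inv_anti₀ (by norm_num) h8
  calc (2 : ℝ) ^ (q / 2) * Real.exp (u / 4 - u * (1 + n) ^ 2 / 2)
      ≤ Real.exp (q / 2) * Real.exp (-X - 2 * q - Y) := by gcongr
    _ ≤ Real.exp (1 - X) * Real.exp (-Y) * Real.exp (-(5 / 2)) := by
        rw [← Real.exp_add, ← Real.exp_add, ← Real.exp_add]
        exact Real.exp_le_exp.2 (by linarith)
    _ ≤ 4 * δ * (2 * rateExponent γ) * (1 / 8) := by
        have := rateExponent_pos hγ
        gcongr
    _ = rateExponent γ * δ := by ring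

/-- The contraction rate of the chain is at most the bound on the rate. -/
theorem lamT_rpow_le_rateBound (hp : 1 ≤ p) (hg : IsStronglyConvexSmooth g m M)
    (hH : IsPreconditioner H mH MH) (hx : IsMinOn g Set.univ xstar) (hγ : 0 < γ)
    (hα0 : lamT γ m M mH MH < α) (hα1 : α < 1) {r : ℝ} (hr0 : 0 < r) (hr1 : r < 1) :
    lamT γ m M mH MH ^ rateExponent γ ≤ rateBound g H xstar γ m M mH MH α r := by
  have hl0 := lamT_nonneg hp hg hH hγ.le
  have hκ := rateExponent_pos hγ
  have hη0 := eta_nonneg (g := g) (xstar := xstar) (γ := γ) (m := m) (M := M) (α := α) hH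
  have hp1 : (1 : ℝ) ≤ p := by exact_mod_cast hp
  have hbT : driftBT p γ m M mH MH = 2 * γ * p + 1 - lamT γ m M mH MH := rfl
  have hb0 : 0 < driftBT p γ m M mH MH := by
    rw [hbT]
    nlinarith [mul_pos hγ (zero_lt_one.trans_le hp1)]
  have hd0 : 0 < level p γ m M mH MH α := div_pos (by linarith) (by linarith)
  have hdelta : 1 - lamT γ m M mH MH ≤ 2 * γ * (m * mH) := by
    rw [lamT]
    nlinarith [sq_nonneg (γ * MH * M)]
  set l := lamT γ m M mH MH
  set b := driftBT p γ m M mH MH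
  set d := level p γ m M mH MH α with hd
  have hld : 0 ≤ l * d := mul_nonneg hl0 hd0.le
  rcases le_or_gt 1 ((1 + 2 * b + l + l * d) / (1 + d)) with hR | hR
  · have h1 : l ^ rateExponent γ ≤ 1 := Real.rpow_le_one hl0 (by linarith) hκ.le
    refine h1.trans (le_max_of_le_right ?_)
    exact one_le_mul_of_one_le_of_one_le (Real.one_le_rpow hR (by linarith))
      (Real.one_le_rpow (by linarith) hr0.le)
  · rw [div_lt_one (by linarith), hbT] at hR
    have hδ : 0 < 1 - l := by linarith
    -- This is the inequality `2b̃ + λ̃ < (1 - λ̃) d` with `b̃` expanded.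
    have hδu : 4 * γ * p + 1 < (1 - l) * (d - 1) := by linarith
    have hu : 0 < d - 1 := by
      refine pos_of_mul_pos_right (lt_trans ?_ hδu) hδ.le
      positivity
    have hη1 := (eta_le hp hg hH hx hu).trans
      (two_rpow_mul_exp_le (q := p) hp1 hγ hδ hu hdelta hδu)
    -- Bernoulli again: `l ^ κ ≤ 1 - κ (1 - l)`, to be set against `η ≤ κ (1 - l)`.
    have h1 := rpow_one_add_le_one_add_mul_self (s := -(1 - l)) (p := rateExponent γ)
      (by linarith) hκ.le ((min_le_right _ _).trans (by norm_num))
    rw [show 1 + -(1 - l) = l by ring] at h1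
    have h2 : 0 ≤ l ^ rateExponent γ := Real.rpow_nonneg hl0 _
    refine le_max_of_le_left ?_
    calc l ^ rateExponent γ ≤ 1 - eta g H xstar γ m M mH MH α := by linarith
      _ ≤ (1 - eta g H xstar γ m M mH MH α) ^ r :=
          Real.self_le_rpow_of_le_one (by linarith) (by linarith) hr1.le

end SmallSet

end PrecLMC

/-! ### Assembly -/

theorem mainTheorem6 (p : ℕ) (hp : 1 ≤ p) (g : PrecLMC.Euc p → ℝ) (m M : ℝ)
    (hg : PrecLMC.IsStronglyConvexSmooth g m M)
    (H : Matrix (Fin p) (Fin p) ℝ) (mH MH : ℝ) (hH : PrecLMC.IsPreconditioner H mH MH)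
    (xstar : PrecLMC.Euc p) (hx : IsMinOn g Set.univ xstar)
    (γ : ℝ) (hγ0 : 0 < γ) (hγ1 : γ < 2 * m * mH / (MH ^ 2 * M ^ 2)) :
    ∃ π : Measure (PrecLMC.Euc p), IsProbabilityMeasure π ∧
      Kernel.Invariant (PrecLMC.lmcKernel g H γ) π ∧
      ∀ α : ℝ, PrecLMC.lamT γ m M mH MH < α → α < 1 → ∀ r : ℝ, 0 < r → r < 1 →
        ∃ ρ : ℝ, ρ ≤ PrecLMC.rateBound g H xstar γ m M mH MH α r ∧
          PrecLMC.IsGeometricallyErgodic (PrecLMC.lmcKernel g H γ) π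
            (fun x => 2 + PrecLMC.driftBT p γ m M mH MH / (1 - PrecLMC.lamT γ m M mH MH)
              + PrecLMC.lyapT H xstar x) ρ := by
  have hl0 := PrecLMC.lamT_nonneg hp hg hH hγ0.le
  have hl1 : PrecLMC.lamT γ m M mH MH < 1 := PrecLMC.lamT_lt_one hγ0 hγ1
  have hδ : 0 < 1 - PrecLMC.lamT γ m M mH MH := by linarith
  have hρ0 : 0 ≤ PrecLMC.lamT γ m M mH MH ^ PrecLMC.rateExponent γ := Real.rpow_nonneg hl0 _
  have hρ1 := Real.rpow_lt_one hl0 hl1 (PrecLMC.rateExponent_pos hγ0)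
  have hV : (fun x : PrecLMC.Euc p => PrecLMC.invQuad H (x - xstar))
      = fun x => ‖PrecLMC.whiten H (x - xstar)‖ ^ 2 :=
    funext fun x => PrecLMC.invQuad_eq_norm_sq hH.posDef _
  obtain ⟨π, hπ, hinv, hconv⟩ := PrecLMC.exists_invariant_of_forgetting
    (PrecLMC.lmcKernel g H γ) (fun x => PrecLMC.invQuad H (x - xstar))
    (by rw [hV]; unfold PrecLMC.whiten PrecLMC.act; fun_prop)
    (fun x => (congrFun hV x).symm ▸ sq_nonneg _) xstar
    (2 * γ * p / (1 - PrecLMC.lamT γ m M mH MH)) _ (by positivity) hρ0 hρ1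
    (fun A hA k x y => PrecLMC.abs_lmcKernel_pow_sub_le_rate hp hg hH hγ0 xstar hA k x y)
    (PrecLMC.lintegral_invQuad_lmcKernel_pow_le hp hg hH hγ0 hx hl1)
  refine ⟨π, hπ, hinv, fun α hα0 hα1 r hr0 hr1 => ⟨_,
    PrecLMC.lamT_rpow_le_rateBound hp hg hH hx hγ0 hα0 hα1 hr0 hr1, hρ0, hρ1, fun x k => ?_⟩⟩
  have : Nonempty {A : Set (PrecLMC.Euc p) // MeasurableSet A} := ⟨⟨∅, .empty⟩⟩
  refine ciSup_le fun A => (hconv A.1 A.2 k x).trans ?_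
  rw [mul_comm]
  refine mul_le_mul_of_nonneg_right ?_ (pow_nonneg hρ0 k)
  -- The stated prefactor exceeds the proved `1 + V(x) + 2γp/(1 - λ̃)` by exactly 3.
  have h1 : PrecLMC.driftBT p γ m M mH MH / (1 - PrecLMC.lamT γ m M mH MH)
      = 2 * γ * p / (1 - PrecLMC.lamT γ m M mH MH) + 1 := by
    rw [PrecLMC.driftBT, PrecLMC.driftB, add_sub_assoc, add_div, div_self hδ.ne']
  simp only [h1, PrecLMC.lyapT]
  linarith
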